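/- Write $\mathrm U[0,1]$ for the uniform distribution on $[0,1]$, and let $\mathcal D_2^{\mathrm U}$ be the set of all probability distributions on $\mathbb R$ of the form "distribution of $X_1+X_2$", where $X_1$ and $X_2$ are random variables on a common probability space, with arbitrary dependence, each having distribution $\mathrm U[0,1]$. Theorem. Let $a,b\in\mathbb R$ and let $F$ be a probability distribution on $\mathbb R$ supported in $[a,a+b]$, with mean $1$ and with a density function $f$ with respect to Lebesgue measure. If there exists $h>0$ such that $$f(x)>\frac{3b}{4h}\qquad\text{for all } x\in[1-h,1+h],$$ then $F\in\mathcal D_2^{\mathrm U}$. -/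

import Mathlib

open MeasureTheory ProbabilityTheory Set

/-- The uniform distribution `U[a, b]`: Lebesgue measure conditioned on the interval `[a, b]`. -/
noncomputable def uniformLaw (a b : ℝ) : Measure ℝ :=
  ProbabilityTheory.cond volume (Icc a b)

/-- `sumLaws n F` is the set `𝒟ₙ(F₁, …, Fₙ)` of all distributions of `X₁ + ⋯ + Xₙ`, where
`X₁, …, Xₙ` are (arbitrarily dependent) random variables on a common probability space
with respective distributions `F₁, …, Fₙ`. -/
def sumLaws (n : ℕ) (F : Fin n → Measure ℝ) : Set (Measure ℝ) :=
  {G | ∃ (Ω : Type) (_ : MeasurableSpace Ω) (P : Measure Ω) (_ : IsProbabilityMeasure P)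
      (X : Fin n → Ω → ℝ),
      (∀ i, HasLaw (X i) (F i) P) ∧ HasLaw (fun ω => ∑ i, X i ω) G P}

/-- `sumUniformLaws n` is `𝒟ₙ(U[0, 1], …, U[0, 1])`. -/
def sumUniformLaws (n : ℕ) : Set (Measure ℝ) :=
  sumLaws n (fun _ => uniformLaw 0 1)

/-! Since `1 - Y` is uniform when `Y` is, it suffices to couple uniform `X`, `Y` on `[0, 1]` so that
`1 + X - Y` has law `F`. Put `c = 3b/2` and split `F = M + U`, where `U` is uniform on `[1-h, 1+h]`
with mass `c` and `M` has mass `1 - c` and barycentre `1`.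

Normalised, `M` is a mixture of two-point laws with mean `1`, on pairs `z₁ < 1 < z₂` with `z₂ - z₁ ≤
b`. It is therefore enough to realise `(1 - c)` times each such law plus `U`, and then to integrate
over the pairs. Swapping adjacent intervals of lengths `z₂ - 1` and `1 - z₁` realises the two-point
law on a block of length `z₂ - z₁`. As many blocks as fit are packed into `[0, 1-h]`. On the
remaining interval, of length at least `h`, uniform variables can be coupled with difference uniform
on `[-h, h]`. The blocks cover more than `1 - c`, and mixing with the coupling that has no blocks
lowers this to exactly `1 - c`.

The carrying lemmas are `map_diff_triangleMeasure`, `map_diff_exchangeMeasure`,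
`map_diff_mixedCoupling` and `exists_coupling_of_add_uniform`. -/

/-! ### Uniform measures on segments and their affine images -/

/-- The uniform distribution on the segment from `p` to `q` in the plane. -/
noncomputable def segmentMeasure (p q : ℝ × ℝ) : Measure (ℝ × ℝ) :=
  (volume.restrict (Icc (0 : ℝ) 1)).map (fun t => p + t • (q - p))

/-- The uniform distribution on the interval with end points `a` and `b`. -/
noncomputable def lineMeasure (a b : ℝ) : Measure ℝ :=
  (volume.restrict (Icc (0 : ℝ) 1)).map (fun t => a + t * (b - a))

lemma lineMeasure_self (a : ℝ) : lineMeasure a a = Measure.dirac a := by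
  simp [lineMeasure]

lemma map_one_sub_restrict_Icc : (volume.restrict (Icc (0 : ℝ) 1)).map (fun t => 1 - t)
    = volume.restrict (Icc (0 : ℝ) 1) := by
  have h := ((Measure.measurePreserving_sub_left (volume : Measure ℝ) 1).restrict_preimage
    (measurableSet_Icc (a := (0 : ℝ)) (b := 1))).map_eq
  simpa using h

lemma lineMeasure_comm (a b : ℝ) : lineMeasure a b = lineMeasure b a := by
  rw [lineMeasure, lineMeasure]
  conv_rhs => rw [← map_one_sub_restrict_Icc]
  rw [Measure.map_map (by fun_prop) (by fun_prop)]
  congr 1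
  ext t
  simp only [Function.comp]
  ring

/-- Prescribing the density `c` rather than the mass avoids dividing by the length, so degenerate
intervals need no separate treatment later. -/
lemma smul_lineMeasure {a b c : ℝ} (hab : a ≤ b) (hc : 0 ≤ c) :
    ENNReal.ofReal (c * (b - a)) • lineMeasure a b
      = ENNReal.ofReal c • volume.restrict (Icc a b) := by
  rcases hab.eq_or_lt with rfl | hab
  · simp
  have hd : 0 < b - a := sub_pos.2 hab
  have hpre : (fun t : ℝ => a + t * (b - a)) ⁻¹' Icc a b = Icc 0 1 := by
    ext t
    simp only [mem_preimage, mem_Icc]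
    constructor
    · rintro ⟨h1, h2⟩
      exact ⟨by nlinarith, by nlinarith⟩
    · rintro ⟨h1, h2⟩
      exact ⟨by nlinarith, by nlinarith⟩
  have hvol : (volume : Measure ℝ).map (fun t : ℝ => a + t * (b - a))
      = ENNReal.ofReal (b - a)⁻¹ • volume := by
    have h1 : (fun t : ℝ => a + t * (b - a)) = (fun t => a + t) ∘ (fun t => t * (b - a)) := rfl
    rw [h1, ← Measure.map_map (by fun_prop) (by fun_prop), Real.map_volume_mul_right hd.ne',
      Measure.map_smul, abs_of_pos (by positivity)]
    congr 1
    exact map_add_left_eq_self volume a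
  rw [lineMeasure, ← hpre, ← Measure.restrict_map (by fun_prop) measurableSet_Icc, hvol,
    Measure.restrict_smul, smul_smul, ← ENNReal.ofReal_mul (by positivity)]
  congr 2
  field_simp

lemma restrict_Icc_add_restrict_Icc {a b c : ℝ} (hab : a ≤ b) (hbc : b ≤ c) :
    (volume : Measure ℝ).restrict (Icc a b) + volume.restrict (Icc b c)
      = volume.restrict (Icc a c) := by
  rw [← Icc_union_Icc_eq_Icc hab hbc,
    Measure.restrict_union₀ _ measurableSet_Icc.nullMeasurableSet]
  refine measure_mono_null (t := {b}) ?_ (by simp)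
  rintro x ⟨⟨_, h1⟩, ⟨h2, _⟩⟩
  exact le_antisymm h1 h2

/-- Measurable functionals that are affine along segments. -/
structure IsAffineFunctional (φ : ℝ × ℝ → ℝ) : Prop where
  measurable : Measurable φ
  map_segment : ∀ p q t, φ (p + t • (q - p)) = φ p + t * (φ q - φ p)

lemma isAffineFunctional_fst : IsAffineFunctional Prod.fst :=
  ⟨measurable_fst, fun p q t => by simp⟩

lemma isAffineFunctional_snd : IsAffineFunctional Prod.snd :=
  ⟨measurable_snd, fun p q t => by simp⟩

lemma isAffineFunctional_diff : IsAffineFunctional (fun p => 1 + p.1 - p.2) :=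
  ⟨by fun_prop, fun p q t => by simp; ring⟩

lemma IsAffineFunctional.map_segmentMeasure {φ : ℝ × ℝ → ℝ} (hφ : IsAffineFunctional φ)
    (p q : ℝ × ℝ) : (segmentMeasure p q).map φ = lineMeasure (φ p) (φ q) := by
  rw [segmentMeasure, Measure.map_map hφ.measurable (by fun_prop), lineMeasure]
  congr 1
  ext t
  exact hφ.map_segment p q t

lemma IsAffineFunctional.map_segment_interval {φ : ℝ × ℝ → ℝ} (hφ : IsAffineFunctional φ)
    {p q : ℝ × ℝ} {a b c w : ℝ} (hab : a ≤ b) (hc : 0 ≤ c) (hw : w = c * (b - a))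
    (h : (φ p = a ∧ φ q = b) ∨ (φ p = b ∧ φ q = a)) :
    (ENNReal.ofReal w • segmentMeasure p q).map φ
      = ENNReal.ofReal c • volume.restrict (Icc a b) := by
  rw [Measure.map_smul, hφ.map_segmentMeasure, hw, ← smul_lineMeasure hab hc]
  rcases h with ⟨h1, h2⟩ | ⟨h1, h2⟩
  · rw [h1, h2]
  · rw [h1, h2, lineMeasure_comm]

lemma IsAffineFunctional.map_segment_point {φ : ℝ × ℝ → ℝ} (hφ : IsAffineFunctional φ)
    {p q : ℝ × ℝ} {a w : ℝ} (h1 : φ p = a) (h2 : φ q = a) :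
    (ENNReal.ofReal w • segmentMeasure p q).map φ = ENNReal.ofReal w • Measure.dirac a := by
  rw [Measure.map_smul, hφ.map_segmentMeasure, h1, h2, lineMeasure_self]

lemma ofReal_add_smul {α : Type*} [MeasurableSpace α] {c d e : ℝ} (hc : 0 ≤ c) (hd : 0 ≤ d)
    (h : c + d = e) (μ : Measure α) :
    ENNReal.ofReal c • μ + ENNReal.ofReal d • μ = ENNReal.ofReal e • μ := by
  rw [← add_smul, ← ENNReal.ofReal_add hc hd, h]

/-! ### The triangle coupling, with uniform difference -/

/-- A coupling of two uniform distributions on `[s, 1]` whose difference is uniform on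
`[-h, h]`. -/
noncomputable def triangleMeasure (h s : ℝ) : Measure (ℝ × ℝ) :=
  ENNReal.ofReal ((1 - s) * (1 - s - h) / (2 * (1 - s) - h)) • segmentMeasure (s, s) (1, 1 - h)
  + ENNReal.ofReal ((1 - s) * (1 - s - h) / (2 * (1 - s) - h)) • segmentMeasure (s, s) (1 - h, 1)
  + ENNReal.ofReal ((1 - s) * h / (2 * (1 - s) - h)) • segmentMeasure (1 - h, 1) (1, 1 - h)

/-- The weights are chosen so that the second and third sides project to `[s, 1-h]` and `[1-h, 1]`
with equal densities. They glue to a constant density on `[s, 1]`, which the first side completes to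
`1`. -/
lemma map_fst_triangleMeasure {h s : ℝ} (hh : 0 < h) (hs : s ≤ 1 - h) :
    (triangleMeasure h s).map Prod.fst = volume.restrict (Icc s 1) := by
  have hφ := isAffineFunctional_fst
  have hr : 0 < 2 * (1 - s) - h := by linarith
  have h0 : 0 ≤ (1 - s - h) / (2 * (1 - s) - h) := div_nonneg (by linarith) hr.le
  have h1 : 0 ≤ (1 - s) / (2 * (1 - s) - h) := div_nonneg (by linarith) hr.le
  rw [triangleMeasure, Measure.map_add _ _ hφ.measurable, Measure.map_add _ _ hφ.measurable,
    hφ.map_segment_interval (a := s) (b := 1) (c := (1 - s - h) / (2 * (1 - s) - h))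
      (by linarith) h0 (by ring) (by simp),
    hφ.map_segment_interval (a := s) (b := 1 - h) (c := (1 - s) / (2 * (1 - s) - h))
      (by linarith) h1 (by ring) (by simp),
    hφ.map_segment_interval (a := 1 - h) (b := 1) (c := (1 - s) / (2 * (1 - s) - h))
      (by linarith) h1 (by ring) (by simp),
    add_assoc, ← smul_add, restrict_Icc_add_restrict_Icc (by linarith) (by linarith),
    ofReal_add_smul h0 h1 (e := 1)
      (by rw [← add_div, div_eq_one_iff_eq hr.ne']; ring)]
  simp

lemma map_snd_triangleMeasure {h s : ℝ} (hh : 0 < h) (hs : s ≤ 1 - h) :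
    (triangleMeasure h s).map Prod.snd = volume.restrict (Icc s 1) := by
  have hφ := isAffineFunctional_snd
  have hr : 0 < 2 * (1 - s) - h := by linarith
  have h0 : 0 ≤ (1 - s - h) / (2 * (1 - s) - h) := div_nonneg (by linarith) hr.le
  have h1 : 0 ≤ (1 - s) / (2 * (1 - s) - h) := div_nonneg (by linarith) hr.le
  rw [triangleMeasure, Measure.map_add _ _ hφ.measurable, Measure.map_add _ _ hφ.measurable,
    hφ.map_segment_interval (a := s) (b := 1 - h) (c := (1 - s) / (2 * (1 - s) - h))
      (by linarith) h1 (by ring) (by simp),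
    hφ.map_segment_interval (a := s) (b := 1) (c := (1 - s - h) / (2 * (1 - s) - h))
      (by linarith) h0 (by ring) (by simp),
    hφ.map_segment_interval (a := 1 - h) (b := 1) (c := (1 - s) / (2 * (1 - s) - h))
      (by linarith) h1 (by ring) (by simp),
    add_right_comm, ← smul_add, restrict_Icc_add_restrict_Icc (by linarith) (by linarith),
    ofReal_add_smul h1 h0 (e := 1)
      (by rw [← add_div, div_eq_one_iff_eq hr.ne']; ring)]
  simp

/-- The sides from `(s, s)` carry equal mass and cover the two halves of the target; the third side
covers it all, so each contribution is uniform. -/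
lemma map_diff_triangleMeasure {h s : ℝ} (hh : 0 < h) (hs : s ≤ 1 - h) :
    (triangleMeasure h s).map (fun p => 1 + p.1 - p.2)
      = ENNReal.ofReal ((1 - s) / (2 * h)) • volume.restrict (Icc (1 - h) (1 + h)) := by
  have hφ := isAffineFunctional_diff
  have hr : 0 < 2 * (1 - s) - h := by linarith
  have h0 : 0 ≤ (1 - s) * (1 - s - h) / ((2 * (1 - s) - h) * h) :=
    div_nonneg (mul_nonneg (by linarith) (by linarith)) (by positivity)
  have h1 : 0 ≤ (1 - s) / (2 * (2 * (1 - s) - h)) := div_nonneg (by linarith) (by positivity)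
  rw [triangleMeasure, Measure.map_add _ _ hφ.measurable, Measure.map_add _ _ hφ.measurable,
    hφ.map_segment_interval (a := 1) (b := 1 + h)
      (c := (1 - s) * (1 - s - h) / ((2 * (1 - s) - h) * h))
      (by linarith) h0 (by field_simp; ring) (Or.inl ⟨by ring, by ring⟩),
    hφ.map_segment_interval (a := 1 - h) (b := 1)
      (c := (1 - s) * (1 - s - h) / ((2 * (1 - s) - h) * h))
      (by linarith) h0 (by field_simp; ring) (Or.inr ⟨by ring, by ring⟩),
    hφ.map_segment_interval (a := 1 - h) (b := 1 + h) (c := (1 - s) / (2 * (2 * (1 - s) - h)))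
      (by linarith) h1 (by field_simp; ring) (Or.inl ⟨by ring, by ring⟩),
    ← smul_add, add_comm (volume.restrict (Icc 1 (1 + h))),
    restrict_Icc_add_restrict_Icc (by linarith) (by linarith),
    ofReal_add_smul h0 h1 (e := (1 - s) / (2 * h))
      (by rw [div_add_div _ _ (by positivity) (by positivity),
            div_eq_div_iff (by positivity) (by positivity)]; ring)]

/-! ### Interval exchanges, with two-valued difference -/

/-- The exchange of two adjacent intervals of lengths `x` and `y`, starting at `m`. -/
noncomputable def exchangeMeasure (x y m : ℝ) : Measure (ℝ × ℝ) :=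
  ENNReal.ofReal x • segmentMeasure (m, m + y) (m + x, m + x + y)
  + ENNReal.ofReal y • segmentMeasure (m + x, m) (m + x + y, m + y)

lemma map_fst_exchangeMeasure {x y : ℝ} (hx : 0 ≤ x) (hy : 0 ≤ y) (m : ℝ) :
    (exchangeMeasure x y m).map Prod.fst = volume.restrict (Icc m (m + (x + y))) := by
  have hφ := isAffineFunctional_fst
  rw [exchangeMeasure, Measure.map_add _ _ hφ.measurable,
    hφ.map_segment_interval (a := m) (b := m + x) (c := 1)
      (by linarith) zero_le_one (by ring) (by simp),
    hφ.map_segment_interval (a := m + x) (b := m + x + y) (c := 1)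
      (by linarith) zero_le_one (by ring) (by simp),
    ← smul_add, restrict_Icc_add_restrict_Icc (by linarith) (by linarith)]
  simp [add_assoc]

lemma map_snd_exchangeMeasure {x y : ℝ} (hx : 0 ≤ x) (hy : 0 ≤ y) (m : ℝ) :
    (exchangeMeasure x y m).map Prod.snd = volume.restrict (Icc m (m + (x + y))) := by
  have hφ := isAffineFunctional_snd
  rw [exchangeMeasure, Measure.map_add _ _ hφ.measurable,
    hφ.map_segment_interval (a := m + y) (b := m + x + y) (c := 1)
      (by linarith) zero_le_one (by ring) (by simp),
    hφ.map_segment_interval (a := m) (b := m + y) (c := 1)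
      (by linarith) zero_le_one (by ring) (by simp),
    ← smul_add, add_comm (volume.restrict (Icc (m + y) _)),
    restrict_Icc_add_restrict_Icc (by linarith) (by linarith)]
  simp [add_assoc]

/-- Both segments are parallel to the diagonal, so the difference is constant on each. The block
lengths are exactly the weights giving barycentre `1`. -/
lemma map_diff_exchangeMeasure (x y m : ℝ) :
    (exchangeMeasure x y m).map (fun p => 1 + p.1 - p.2)
      = ENNReal.ofReal x • Measure.dirac (1 - y) + ENNReal.ofReal y • Measure.dirac (1 + x) := by
  have hφ := isAffineFunctional_diff
  rw [exchangeMeasure, Measure.map_add _ _ hφ.measurable,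
    hφ.map_segment_point (a := 1 - y) (by ring) (by ring),
    hφ.map_segment_point (a := 1 + x) (by ring) (by ring)]

/-- `n` consecutive exchanges of adjacent intervals of lengths `x` and `y`, starting at `0`. -/
noncomputable def exchangesMeasure (n : ℕ) (x y : ℝ) : Measure (ℝ × ℝ) :=
  ∑ k ∈ Finset.range n, exchangeMeasure x y (k * (x + y))

lemma exchangesMeasure_succ (n : ℕ) (x y : ℝ) :
    exchangesMeasure (n + 1) x y = exchangesMeasure n x y + exchangeMeasure x y (n * (x + y)) :=
  Finset.sum_range_succ _ _

lemma map_exchangesMeasure_of_forall {φ : ℝ × ℝ → ℝ} (hφ : Measurable φ) {x y : ℝ}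
    (hx : 0 ≤ x) (hy : 0 ≤ y)
    (h : ∀ m, (exchangeMeasure x y m).map φ = volume.restrict (Icc m (m + (x + y)))) (n : ℕ) :
    (exchangesMeasure n x y).map φ = volume.restrict (Icc 0 (n * (x + y))) := by
  induction n with
  | zero => simp [exchangesMeasure]
  | succ n ih =>
    rw [exchangesMeasure_succ, Measure.map_add _ _ hφ, ih, h,
      restrict_Icc_add_restrict_Icc (by positivity) (by linarith)]
    congr 2
    push_cast
    ring

lemma map_diff_exchangesMeasure (n : ℕ) (x y : ℝ) :
    (exchangesMeasure n x y).map (fun p => 1 + p.1 - p.2)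
      = (n : ENNReal) • (ENNReal.ofReal x • Measure.dirac (1 - y)
        + ENNReal.ofReal y • Measure.dirac (1 + x)) := by
  induction n with
  | zero => simp [exchangesMeasure]
  | succ n ih =>
    rw [exchangesMeasure_succ, Measure.map_add _ _ (by fun_prop), ih, map_diff_exchangeMeasure]
    push_cast
    rw [add_smul, one_smul]

/-! ### Mixing exchanges with the triangle coupling -/

/-- A coupling of two uniform distributions on `[0, 1]`: with weight `l`, the interval
`[0, n (x + y)]` is split into `n` exchanges. -/
noncomputable def mixedCoupling (h l : ℝ) (n : ℕ) (x y : ℝ) : Measure (ℝ × ℝ) :=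
  ENNReal.ofReal l • (exchangesMeasure n x y + triangleMeasure h (n * (x + y)))
    + ENNReal.ofReal (1 - l) • triangleMeasure h 0

lemma map_mixedCoupling {φ : ℝ × ℝ → ℝ} (hφ : Measurable φ) {h l x y : ℝ} {n : ℕ} :
    (mixedCoupling h l n x y).map φ =
      ENNReal.ofReal l • ((exchangesMeasure n x y).map φ
        + (triangleMeasure h (n * (x + y))).map φ)
      + ENNReal.ofReal (1 - l) • (triangleMeasure h 0).map φ := by
  rw [mixedCoupling, Measure.map_add _ _ hφ, Measure.map_smul, Measure.map_smul,
    Measure.map_add _ _ hφ]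

lemma map_fst_mixedCoupling {h l x y : ℝ} {n : ℕ} (hh : 0 < h) (hl0 : 0 ≤ l) (hl1 : l ≤ 1)
    (hx : 0 ≤ x) (hy : 0 ≤ y) (hn : n * (x + y) ≤ 1 - h) :
    (mixedCoupling h l n x y).map Prod.fst = volume.restrict (Icc 0 1) := by
  have hp : 0 ≤ n * (x + y) := by positivity
  rw [map_mixedCoupling measurable_fst,
    map_exchangesMeasure_of_forall measurable_fst hx hy (map_fst_exchangeMeasure hx hy),
    map_fst_triangleMeasure hh hn, map_fst_triangleMeasure hh (by linarith),
    restrict_Icc_add_restrict_Icc hp (by linarith),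
    ofReal_add_smul hl0 (by linarith) (e := 1) (by ring)]
  simp

lemma map_snd_mixedCoupling {h l x y : ℝ} {n : ℕ} (hh : 0 < h) (hl0 : 0 ≤ l) (hl1 : l ≤ 1)
    (hx : 0 ≤ x) (hy : 0 ≤ y) (hn : n * (x + y) ≤ 1 - h) :
    (mixedCoupling h l n x y).map Prod.snd = volume.restrict (Icc 0 1) := by
  have hp : 0 ≤ n * (x + y) := by positivity
  rw [map_mixedCoupling measurable_snd,
    map_exchangesMeasure_of_forall measurable_snd hx hy (map_snd_exchangeMeasure hx hy),
    map_snd_triangleMeasure hh hn, map_snd_triangleMeasure hh (by linarith),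
    restrict_Icc_add_restrict_Icc hp (by linarith),
    ofReal_add_smul hl0 (by linarith) (e := 1) (by ring)]
  simp

/-- Only the total exchanged mass matters: `hc` fixes it at `1 - c`, and the rest of the unit mass
is uniform whatever `n` and `l` are. -/
lemma map_diff_mixedCoupling {h l c x y : ℝ} {n : ℕ} (hh : 0 < h) (hl0 : 0 ≤ l) (hl1 : l ≤ 1)
    (hx : 0 < x) (hy : 0 < y) (hn : n * (x + y) ≤ 1 - h) (hc : l * (n * (x + y)) = 1 - c) :
    (mixedCoupling h l n x y).map (fun p => 1 + p.1 - p.2)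
      = ENNReal.ofReal ((1 - c) * x / (x + y)) • Measure.dirac (1 - y)
        + ENNReal.ofReal ((1 - c) * y / (x + y)) • Measure.dirac (1 + x)
        + ENNReal.ofReal (c / (2 * h)) • volume.restrict (Icc (1 - h) (1 + h)) := by
  have hxy : 0 < x + y := by positivity
  have hp : 0 ≤ n * (x + y) := by positivity
  have e1 : l * ((n : ℝ) * x) = (1 - c) * x / (x + y) := by
    rw [← hc]; field_simp
  have e2 : l * ((n : ℝ) * y) = (1 - c) * y / (x + y) := by
    rw [← hc]; field_simp
  have e3 : l * ((1 - n * (x + y)) / (2 * h)) + (1 - l) * ((1 - 0) / (2 * h)) = c / (2 * h) := by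
    field_simp
    linarith
  rw [map_mixedCoupling (by fun_prop), map_diff_exchangesMeasure,
    map_diff_triangleMeasure hh hn, map_diff_triangleMeasure hh (by linarith), ← e1, ← e2, ← e3,
    ENNReal.ofReal_add (mul_nonneg hl0 (div_nonneg (by linarith) (by positivity)))
      (mul_nonneg (by linarith) (by positivity)), add_smul,
    ENNReal.ofReal_mul hl0, ENNReal.ofReal_mul hl0, ENNReal.ofReal_mul hl0,
    ENNReal.ofReal_mul (by linarith : 0 ≤ 1 - l), ENNReal.ofReal_mul (Nat.cast_nonneg n),
    ENNReal.ofReal_mul (Nat.cast_nonneg n), ENNReal.ofReal_natCast]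
  simp only [smul_add, smul_smul, add_assoc]

/-! ### Measurable dependence of the couplings on their parameters -/

lemma measurable_measure_smul {α β : Type*} [MeasurableSpace α] [MeasurableSpace β]
    {w : α → ENNReal} {κ : α → Measure β} (hw : Measurable w) (hκ : Measurable κ) :
    Measurable (fun z => w z • κ z) := by
  refine Measure.measurable_of_measurable_coe _ fun s hs => ?_
  exact hw.mul ((Measure.measurable_coe hs).comp hκ)

lemma measurable_measure_add {α β : Type*} [MeasurableSpace α] [MeasurableSpace β]
    {κ η : α → Measure β} (hκ : Measurable κ) (hη : Measurable η) :
    Measurable (fun z => κ z + η z) := by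
  refine Measure.measurable_of_measurable_coe _ fun s hs => ?_
  exact ((Measure.measurable_coe hs).comp hκ).add ((Measure.measurable_coe hs).comp hη)

lemma measurable_segmentMeasure {α : Type*} [MeasurableSpace α] {P Q : α → ℝ × ℝ}
    (hP : Measurable P) (hQ : Measurable Q) :
    Measurable (fun z => segmentMeasure (P z) (Q z)) := by
  refine Measure.measurable_of_measurable_coe _ fun s hs => ?_
  have hm : Measurable (fun u : α × ℝ => P u.1 + u.2 • (Q u.1 - P u.1)) := by fun_prop
  have := measurable_measure_prodMk_left (ν := volume.restrict (Icc (0 : ℝ) 1)) (hm hs)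
  convert this using 2 with z
  rw [segmentMeasure, Measure.map_apply (by fun_prop) hs]
  rfl

lemma measurable_triangleMeasure {α : Type*} [MeasurableSpace α] (h : ℝ) {s : α → ℝ}
    (hs : Measurable s) : Measurable (fun z => triangleMeasure h (s z)) := by
  refine measurable_measure_add (measurable_measure_add ?_ ?_) ?_ <;>
    exact measurable_measure_smul (by fun_prop) (measurable_segmentMeasure (by fun_prop)
      (by fun_prop))

lemma measurable_exchangeMeasure {α : Type*} [MeasurableSpace α] {x y m : α → ℝ}
    (hx : Measurable x) (hy : Measurable y) (hm : Measurable m) :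
    Measurable (fun z => exchangeMeasure (x z) (y z) (m z)) := by
  refine measurable_measure_add ?_ ?_ <;>
    exact measurable_measure_smul (by fun_prop) (measurable_segmentMeasure (by fun_prop)
      (by fun_prop))

lemma measurable_exchangesMeasure_const {α : Type*} [MeasurableSpace α] (n : ℕ) {x y : α → ℝ}
    (hx : Measurable x) (hy : Measurable y) :
    Measurable (fun z => exchangesMeasure n (x z) (y z)) := by
  induction n with
  | zero => simp only [exchangesMeasure, Finset.range_zero, Finset.sum_empty, measurable_const]
  | succ k ih =>
    simp only [exchangesMeasure_succ]
    exact measurable_measure_add ih (measurable_exchangeMeasure hx hy (by fun_prop))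

lemma measurable_apply_nat {α β : Type*} [MeasurableSpace α] [MeasurableSpace β] {n : α → ℕ}
    (hn : Measurable n) {g : ℕ → α → β} (hg : ∀ k, Measurable (g k)) :
    Measurable (fun z => g (n z) z) := by
  intro s hs
  have : (fun z => g (n z) z) ⁻¹' s = ⋃ k, (n ⁻¹' {k} ∩ g k ⁻¹' s) := by
    ext z
    simp
  rw [this]
  exact MeasurableSet.iUnion fun k => (hn (measurableSet_singleton k)).inter (hg k hs)

lemma measurable_exchangesMeasure {α : Type*} [MeasurableSpace α] {n : α → ℕ} {x y : α → ℝ}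
    (hn : Measurable n) (hx : Measurable x) (hy : Measurable y) :
    Measurable (fun z => exchangesMeasure (n z) (x z) (y z)) :=
  measurable_apply_nat (g := fun k z => exchangesMeasure k (x z) (y z)) hn
    fun k => measurable_exchangesMeasure_const k hx hy

lemma measurable_mixedCoupling {α : Type*} [MeasurableSpace α] (h : ℝ) {l : α → ℝ} {n : α → ℕ}
    {x y : α → ℝ} (hl : Measurable l) (hn : Measurable n) (hx : Measurable x)
    (hy : Measurable y) : Measurable (fun z => mixedCoupling h (l z) (n z) (x z) (y z)) := by
  have hn' : Measurable (fun z => (n z : ℝ)) := measurable_from_top.comp hn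
  exact measurable_measure_add
    (measurable_measure_smul (by fun_prop) (measurable_measure_add
      (measurable_exchangesMeasure hn hx hy) (measurable_triangleMeasure h (by fun_prop))))
    (measurable_measure_smul (by fun_prop) measurable_const)

lemma map_bind_measure {α β γ : Type*} [MeasurableSpace α] [MeasurableSpace β]
    [MeasurableSpace γ] {Q : Measure α} {κ : α → Measure β} (hκ : Measurable κ) {φ : β → γ}
    (hφ : Measurable φ) : (Q.bind κ).map φ = Q.bind (fun z => (κ z).map φ) := by
  ext s hs
  rw [Measure.map_apply hφ hs, Measure.bind_apply (hφ hs) hκ.aemeasurable,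
    Measure.bind_apply (f := fun z => (κ z).map φ) hs
      ((Measure.measurable_map φ hφ).comp hκ).aemeasurable]
  simp_rw [Measure.map_apply hφ hs]

/-! ### Centred measures as mixtures of two-point laws -/

lemma lintegral_Ioi_ofReal_sub (M : Measure ℝ) (m : ℝ) :
    ∫⁻ x in Ioi m, ENNReal.ofReal (x - m) ∂M = ∫⁻ x, ENNReal.ofReal (x - m) ∂M := by
  rw [← lintegral_indicator measurableSet_Ioi]
  refine lintegral_congr fun x => ?_
  by_cases hx : x ∈ Ioi m
  · simp [hx]
  · rw [indicator_of_notMem hx, ENNReal.ofReal_of_nonpos (sub_nonpos.2 (not_lt.1 hx))]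

lemma lintegral_Iio_ofReal_sub (M : Measure ℝ) (m : ℝ) :
    ∫⁻ x in Iio m, ENNReal.ofReal (m - x) ∂M = ∫⁻ x, ENNReal.ofReal (m - x) ∂M := by
  rw [← lintegral_indicator measurableSet_Iio]
  refine lintegral_congr fun x => ?_
  by_cases hx : x ∈ Iio m
  · simp [hx]
  · rw [indicator_of_notMem hx, ENNReal.ofReal_of_nonpos (sub_nonpos.2 (not_lt.1 hx))]

lemma restrict_Iio_add_restrict_Ioi {M : Measure ℝ} {m : ℝ} (h : M {m} = 0) :
    M.restrict (Iio m) + M.restrict (Ioi m) = M := by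
  rw [← Measure.restrict_union (by
    rw [Set.disjoint_left]; exact fun x hx hx' => lt_asymm (mem_Iio.1 hx) (mem_Ioi.1 hx')) measurableSet_Ioi,
    Iio_union_Ioi]
  refine Measure.restrict_eq_self_of_ae_mem ?_
  rwa [ae_iff, show {a | a ∉ ({m} : Set ℝ)ᶜ} = {m} by ext; simp]

/-- With `u x = 1 - x` and `v x = x - 1`, the equality of the two first moments lets the product
measure recover `M₁ + M₂` from its pairs, up to the factor `μ`. -/
lemma lintegral_prod_cross {M₁ M₂ : Measure ℝ} [SFinite M₁] [SFinite M₂] {μ : ENNReal}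
    {u v g₁ g₂ : ℝ → ENNReal} (hu : Measurable u) (hv : Measurable v) (hg₁ : Measurable g₁)
    (hg₂ : Measurable g₂) (hμ₁ : ∫⁻ x, u x ∂M₁ = μ) (hμ₂ : ∫⁻ x, v x ∂M₂ = μ) :
    ∫⁻ z, (g₁ z.1 * v z.2 + u z.1 * g₂ z.2) ∂(M₁.prod M₂)
      = μ * (∫⁻ x, g₁ x ∂M₁ + ∫⁻ x, g₂ x ∂M₂) := by
  rw [lintegral_add_left (by fun_prop), lintegral_prod_mul hg₁.aemeasurable hv.aemeasurable,
    lintegral_prod_mul hu.aemeasurable hg₂.aemeasurable, hμ₁, hμ₂, mul_add, mul_comm]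

/-- The floor weight used to split the unit interval satisfies the required bounds. -/
lemma floor_mul_bounds {h L : ℝ} (hh : h < 1) (hL : 0 < L) :
    (⌊(1 - h) / L⌋₊ : ℝ) * L ≤ 1 - h ∧ 1 - h - L < (⌊(1 - h) / L⌋₊ : ℝ) * L := by
  have h0 : 0 ≤ (1 - h) / L := div_nonneg (by linarith) hL.le
  have h1 := (le_div_iff₀ hL).1 (Nat.floor_le h0)
  have h2 := (div_lt_iff₀ hL).1 (Nat.lt_floor_add_one ((1 - h) / L))
  exact ⟨h1, by linarith⟩

/-- The value `3b/2` bounds the length that blocks may leave uncovered: `h ≤ b/2` reserved at the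
end, plus less than one block, of length at most `b`. -/
lemma exists_coupling_of_add_uniform {M : Measure ℝ} [IsFiniteMeasure M] {a b h c : ℝ}
    (hh : 0 < h) (hb : 2 * h ≤ b) (hc : c = 3 * b / 2) (hc1 : c < 1)
    (hmass : M univ = ENNReal.ofReal (1 - c)) (hatom : M {1} = 0)
    (hmean : ∫⁻ x, ENNReal.ofReal (1 - x) ∂M = ∫⁻ x, ENNReal.ofReal (x - 1) ∂M)
    (hfin : ∫⁻ x, ENNReal.ofReal (x - 1) ∂M ≠ ⊤) (hsupp : ∀ᵐ x ∂M, x ∈ Icc a (a + b)) :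
    ∃ P : Measure (ℝ × ℝ), P.map Prod.fst = volume.restrict (Icc 0 1) ∧
      P.map Prod.snd = volume.restrict (Icc 0 1) ∧
      P.map (fun p => 1 + p.1 - p.2)
        = M + ENNReal.ofReal (c / (2 * h)) • volume.restrict (Icc (1 - h) (1 + h)) := by
  set M₁ := M.restrict (Iio 1) with hM₁
  set M₂ := M.restrict (Ioi 1) with hM₂
  have hsum : M₁ + M₂ = M := restrict_Iio_add_restrict_Ioi hatom
  set μ := ∫⁻ x, ENNReal.ofReal (x - 1) ∂M with hμ
  have hμ₁ : ∫⁻ x, ENNReal.ofReal (1 - x) ∂M₁ = μ := by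
    rw [hM₁, lintegral_Iio_ofReal_sub, hmean]
  have hμ₂ : ∫⁻ x, ENNReal.ofReal (x - 1) ∂M₂ = μ := by
    rw [hM₂, lintegral_Ioi_ofReal_sub]
  have hc0 : 0 < 1 - c := by linarith
  -- If the common first moment vanished, both halves of `M` would be zero, contradicting its mass
  -- `1 - c > 0`.
  have hμ0 : μ ≠ 0 := by
    intro h0
    have h2 : M₂ = 0 := by
      have e : ∀ᵐ x ∂M₂, ENNReal.ofReal (x - 1) = 0 :=
        (lintegral_eq_zero_iff (by fun_prop)).1 (hμ₂.trans h0)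
      rw [← ae_eq_bot, ← Filter.eventually_false_iff_eq_bot]
      filter_upwards [e, ae_restrict_mem measurableSet_Ioi] with x h1 h2
      rw [ENNReal.ofReal_eq_zero] at h1
      have := mem_Ioi.1 h2
      linarith
    have h1 : M₁ = 0 := by
      have e : ∀ᵐ x ∂M₁, ENNReal.ofReal (1 - x) = 0 :=
        (lintegral_eq_zero_iff (by fun_prop)).1 (hμ₁.trans h0)
      rw [← ae_eq_bot, ← Filter.eventually_false_iff_eq_bot]
      filter_upwards [e, ae_restrict_mem measurableSet_Iio] with x h1 h2
      rw [ENNReal.ofReal_eq_zero] at h1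
      have := mem_Iio.1 h2
      linarith
    rw [← hsum, h1, h2] at hmass
    simp only [add_zero, Measure.coe_zero, Pi.zero_apply] at hmass
    exact (ENNReal.ofReal_pos.2 hc0).ne hmass
  set k := ENNReal.ofReal (1 - c) with hk
  have hk0 : k ≠ 0 := (ENNReal.ofReal_pos.2 hc0).ne'
  have hkt : k ≠ ⊤ := ENNReal.ofReal_ne_top
  have hkμ : (k * μ)⁻¹ * (k * μ) = 1 :=
    ENNReal.inv_mul_cancel (mul_ne_zero hk0 hμ0) (ENNReal.mul_ne_top hkt hfin)
  -- The density `z.2 - z.1` cancels the denominator in the two-point weights.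
  set R := (M₁.prod M₂).withDensity (fun z => ENNReal.ofReal (z.2 - z.1)) with hR
  set Q := (k * μ)⁻¹ • R with hQ
  have hprod : ∀ᵐ z ∂(M₁.prod M₂), z.1 < 1 ∧ 1 < z.2 ∧ z.2 - z.1 ≤ b := by
    have a1 : ∀ᵐ x ∂M₁, x < 1 ∧ a ≤ x := by
      filter_upwards [ae_restrict_mem measurableSet_Iio, ae_restrict_of_ae hsupp] with x h1 h2
      exact ⟨h1, h2.1⟩
    have a2 : ∀ᵐ x ∂M₂, 1 < x ∧ x ≤ a + b := by
      filter_upwards [ae_restrict_mem measurableSet_Ioi, ae_restrict_of_ae hsupp] with x h1 h2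
      exact ⟨h1, h2.2⟩
    filter_upwards [Measure.quasiMeasurePreserving_fst.ae a1,
      Measure.quasiMeasurePreserving_snd.ae a2] with z h1 h2
    exact ⟨h1.1, h2.1, by linarith [h1.2, h2.2]⟩
  have hQac : Q ≪ M₁.prod M₂ :=
    Measure.smul_absolutelyContinuous.trans (withDensity_absolutelyContinuous _ _)
  have hQae : ∀ᵐ z ∂Q, z.1 < 1 ∧ 1 < z.2 ∧ z.2 - z.1 ≤ b := hQac.ae_le hprod
  have hQint : ∀ {F : ℝ × ℝ → ENNReal}, Measurable F →
      ∫⁻ z, F z ∂Q = (k * μ)⁻¹ * ∫⁻ z, ENNReal.ofReal (z.2 - z.1) * F z ∂(M₁.prod M₂) := by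
    intro F hF
    rw [hQ, lintegral_smul_measure, hR,
      lintegral_withDensity_eq_lintegral_mul _ (by fun_prop) hF]
    rfl
  have hQuniv : Q univ = 1 := by
    rw [← lintegral_one, hQint measurable_const]
    have e : ∫⁻ z, ENNReal.ofReal (z.2 - z.1) * 1 ∂(M₁.prod M₂) = μ * k := by
      rw [hmass.symm, ← hsum, Measure.add_apply, ← lintegral_one, ← lintegral_one (μ := M₂),
        ← lintegral_prod_cross (u := fun x => ENNReal.ofReal (1 - x))
          (v := fun x => ENNReal.ofReal (x - 1)) (by fun_prop) (by fun_prop) measurable_const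
          measurable_const hμ₁ hμ₂]
      refine lintegral_congr_ae ?_
      filter_upwards [hprod] with z hz
      rw [mul_one, one_mul, mul_one, ← ENNReal.ofReal_add (by linarith) (by linarith)]
      congr 1
      ring
    rw [e, mul_comm μ k, hkμ]
  let n : ℝ × ℝ → ℕ := fun z => ⌊(1 - h) / (z.2 - z.1)⌋₊
  have hn : Measurable n := by
    refine Nat.measurable_floor.comp ?_
    fun_prop
  -- Chosen so that the exchanged mass is `1 - c` for every pair.
  let l : ℝ × ℝ → ℝ := fun z => (1 - c) / (n z * (z.2 - z.1))
  have hl : Measurable l := by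
    have : Measurable (fun z => (n z : ℝ)) := measurable_from_top.comp hn
    fun_prop
  let κ : ℝ × ℝ → Measure (ℝ × ℝ) := fun z => mixedCoupling h (l z) (n z) (z.2 - 1) (1 - z.1)
  have hκ : Measurable κ := measurable_mixedCoupling h hl hn (by fun_prop) (by fun_prop)
  have key : ∀ z : ℝ × ℝ, z.1 < 1 ∧ 1 < z.2 ∧ z.2 - z.1 ≤ b →
      0 ≤ l z ∧ l z ≤ 1 ∧ n z * ((z.2 - 1) + (1 - z.1)) ≤ 1 - h ∧
        l z * (n z * ((z.2 - 1) + (1 - z.1))) = 1 - c := by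
    rintro z ⟨h1, h2, h3⟩
    obtain ⟨f1, f2⟩ := floor_mul_bounds (h := h) (L := z.2 - z.1) (by linarith) (by linarith)
    -- Here `1 - h - (z.2 - z.1) ≥ 1 - b/2 - b = 1 - c`; in particular `n z` is nonzero.
    have f3 : 1 - c < n z * (z.2 - z.1) := by
      change 1 - c < (⌊(1 - h) / (z.2 - z.1)⌋₊ : ℝ) * (z.2 - z.1)
      linarith
    have e : (z.2 - 1) + (1 - z.1) = z.2 - z.1 := by ring
    rw [e]
    refine ⟨div_nonneg hc0.le (by linarith), (div_le_one (by linarith)).2 f3.le, f1, ?_⟩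
    exact div_mul_cancel₀ _ (by linarith)
  refine ⟨Q.bind κ, ?_, ?_, ?_⟩
  · rw [map_bind_measure hκ measurable_fst,
      Measure.bind_congr_right (g := fun _ => volume.restrict (Icc 0 1)), Measure.bind_const,
      hQuniv, one_smul]
    filter_upwards [hQae] with z hz
    obtain ⟨k1, k2, k3, k4⟩ := key z hz
    exact map_fst_mixedCoupling hh k1 k2 (by linarith) (by linarith) k3
  · rw [map_bind_measure hκ measurable_snd,
      Measure.bind_congr_right (g := fun _ => volume.restrict (Icc 0 1)), Measure.bind_const,
      hQuniv, one_smul]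
    filter_upwards [hQae] with z hz
    obtain ⟨k1, k2, k3, k4⟩ := key z hz
    exact map_snd_mixedCoupling hh k1 k2 (by linarith) (by linarith) k3
  · set U := ENNReal.ofReal (c / (2 * h)) • (volume : Measure ℝ).restrict (Icc (1 - h) (1 + h))
    rw [map_bind_measure hκ (by fun_prop),
      Measure.bind_congr_right (g := fun z =>
        ENNReal.ofReal ((1 - c) * (z.2 - 1) / (z.2 - z.1)) • Measure.dirac z.1
        + ENNReal.ofReal ((1 - c) * (1 - z.1) / (z.2 - z.1)) • Measure.dirac z.2 + U)]
    · ext s hs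
      have hi : Measurable (s.indicator (1 : ℝ → ENNReal)) := measurable_one.indicator hs
      rw [Measure.bind_apply hs (by
        refine (measurable_measure_add (measurable_measure_add
          (measurable_measure_smul ?_ ?_) (measurable_measure_smul ?_ ?_))
          measurable_const).aemeasurable
        · fun_prop
        · exact Measure.measurable_dirac.comp measurable_fst
        · fun_prop
        · exact Measure.measurable_dirac.comp measurable_snd)]
      simp only [Measure.add_apply, Measure.smul_apply, Measure.dirac_apply' _ hs, smul_eq_mul]
      rw [lintegral_add_right _ measurable_const, lintegral_const, hQuniv, mul_one]
      congr 1
      rw [hQint (by fun_prop)]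
      have e : ∫⁻ z, ENNReal.ofReal (z.2 - z.1) *
          (ENNReal.ofReal ((1 - c) * (z.2 - 1) / (z.2 - z.1)) * s.indicator 1 z.1
          + ENNReal.ofReal ((1 - c) * (1 - z.1) / (z.2 - z.1)) * s.indicator 1 z.2)
            ∂(M₁.prod M₂) = k * (μ * M s) := by
        rw [← hsum, Measure.add_apply, ← lintegral_indicator_one hs, ← lintegral_indicator_one hs,
          ← lintegral_prod_cross (u := fun x => ENNReal.ofReal (1 - x))
            (v := fun x => ENNReal.ofReal (x - 1)) (by fun_prop) (by fun_prop) hi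
            hi hμ₁ hμ₂, ← lintegral_const_mul _ (by fun_prop)]
        refine lintegral_congr_ae ?_
        filter_upwards [hprod] with z hz
        have hL : 0 < z.2 - z.1 := by linarith
        rw [mul_add, mul_add, ← mul_assoc, ← mul_assoc, ← ENNReal.ofReal_mul hL.le,
          ← ENNReal.ofReal_mul hL.le, mul_div_cancel₀ _ hL.ne', mul_div_cancel₀ _ hL.ne',
          ENNReal.ofReal_mul hc0.le, ENNReal.ofReal_mul hc0.le]
        ring
      rw [e, ← mul_assoc k, ← mul_assoc, hkμ, one_mul]
    · filter_upwards [hQae] with z hz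
      obtain ⟨k1, k2, k3, k4⟩ := key z hz
      have := map_diff_mixedCoupling hh k1 k2 (by linarith) (by linarith) k3 k4
      refine this.trans ?_
      rw [show (z.2 - 1) + (1 - z.1) = z.2 - z.1 by ring, show 1 - (1 - z.1) = z.1 by ring,
        show 1 + (z.2 - 1) = z.2 by ring]

/-! ### Reduction of the theorem to a coupling -/

lemma uniformLaw_zero_one : uniformLaw 0 1 = volume.restrict (Icc 0 1) := by
  simp [uniformLaw, ProbabilityTheory.cond]

lemma mem_sumUniformLaws_two_of_coupling {F : Measure ℝ} {P : Measure (ℝ × ℝ)}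
    (h1 : P.map Prod.fst = volume.restrict (Icc 0 1))
    (h2 : P.map Prod.snd = volume.restrict (Icc 0 1))
    (h3 : P.map (fun p => 1 + p.1 - p.2) = F) : F ∈ sumUniformLaws 2 := by
  have hP : IsProbabilityMeasure P := by
    constructor
    have : P.map Prod.fst univ = 1 := by rw [h1]; simp
    rwa [Measure.map_apply measurable_fst MeasurableSet.univ, preimage_univ] at this
  refine ⟨ℝ × ℝ, inferInstance, P, hP, ![Prod.fst, fun p => 1 - p.2], ?_, ?_⟩
  · intro i
    fin_cases i
    · exact ⟨measurable_fst.aemeasurable, by simpa [uniformLaw_zero_one] using h1⟩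
    · refine ⟨by simp only [Fin.mk_one, Matrix.cons_val_one, Matrix.cons_val_fin_one]; fun_prop,
        ?_⟩
      change P.map ((fun t : ℝ => 1 - t) ∘ Prod.snd) = uniformLaw 0 1
      rw [← Measure.map_map (by fun_prop) measurable_snd, h2, map_one_sub_restrict_Icc,
        uniformLaw_zero_one]
  · have e : (fun ω : ℝ × ℝ => ∑ i, (![Prod.fst, fun p => 1 - p.2] : Fin 2 → ℝ × ℝ → ℝ) i ω)
        = fun p => 1 + p.1 - p.2 := by
      ext p
      simp
      ring
    rw [e]
    exact ⟨by fun_prop, h3⟩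

lemma lintegral_pos_part_eq_neg_part {M : Measure ℝ} {u : ℝ → ℝ} (hu : Integrable u M)
    (h0 : ∫ x, u x ∂M = 0) :
    ∫⁻ x, ENNReal.ofReal (-u x) ∂M = ∫⁻ x, ENNReal.ofReal (u x) ∂M := by
  rw [integral_eq_lintegral_pos_part_sub_lintegral_neg_part hu] at h0
  exact ((ENNReal.toReal_eq_toReal_iff' hu.lintegral_lt_top.ne hu.neg.lintegral_lt_top.ne).1
    (sub_eq_zero.1 h0)).symm

lemma withDensity_indicator_const (J : Set ℝ) (hJ : MeasurableSet J) (r : ENNReal) :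
    (volume : Measure ℝ).withDensity (J.indicator fun _ => r) = r • volume.restrict J := by
  rw [withDensity_indicator hJ, withDensity_const]

lemma volume_eq_zero_of_withDensity {g : ℝ → ENNReal} (hg : AEMeasurable g volume) {J : Set ℝ}
    (hpos : ∀ x ∈ J, g x ≠ 0) (h0 : (volume : Measure ℝ).withDensity g J = 0) :
    volume J = 0 := by
  rw [withDensity_apply_eq_zero' hg] at h0
  exact measure_mono_null (fun x hx => mem_inter (hpos x hx) hx) h0

theorem mainTheorem5 (F : Measure ℝ) [IsProbabilityMeasure F] (a b : ℝ)
    (hsupp : F.support ⊆ Icc a (a + b))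
    (hmean : ∫ x, x ∂F = 1)
    (f : ℝ → ℝ) (hf_meas : AEMeasurable f volume) (hf_nonneg : ∀ x, 0 ≤ f x)
    (hf_density : F = volume.withDensity (fun x => ENNReal.ofReal (f x)))
    (hdom : ∃ h : ℝ, 0 < h ∧ ∀ x ∈ Icc (1 - h) (1 + h), 3 * b / (4 * h) < f x) :
    F ∈ sumUniformLaws 2 := by
  obtain ⟨h, hh, hdom⟩ := hdom
  set ρ := 3 * b / (4 * h) with hρ
  set J := Icc (1 - h) (1 + h) with hJ
  have hJm : MeasurableSet J := measurableSet_Icc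
  have hJvol : volume J = ENNReal.ofReal (2 * h) := by
    rw [hJ, Real.volume_Icc]
    congr 1
    ring
  have hJpos : volume J ≠ 0 := by
    rw [hJvol]
    exact (ENNReal.ofReal_pos.2 (by positivity)).ne'
  have hFI : ∀ᵐ x ∂F, x ∈ Icc a (a + b) := Filter.mem_of_superset Measure.support_mem_ae hsupp
  have hb0 : 0 ≤ b := by
    obtain ⟨x, hx⟩ := Measure.nonempty_support (IsProbabilityMeasure.ne_zero F)
    linarith [(hsupp hx).1, (hsupp hx).2]
  have hρ0 : 0 ≤ ρ := by positivity
  -- The density is positive on `J`, so `J` lies in `[a, a + b]` up to a null set.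
  have hb : 2 * h ≤ b := by
    have hnull : volume (J \ Icc a (a + b)) = 0 := by
      refine volume_eq_zero_of_withDensity hf_meas.ennreal_ofReal (fun x hx => ?_)
        (hf_density ▸ measure_mono_null (fun x hx => hx.2) hFI)
      exact (ENNReal.ofReal_pos.2 (hρ0.trans_lt (hdom x hx.1))).ne'
    have hle : volume J ≤ volume (Icc a (a + b)) := by
      refine (measure_le_inter_add_sdiff volume J (Icc a (a + b))).trans ?_
      rw [hnull, add_zero]
      exact measure_mono inter_subset_right
    rw [hJvol, Real.volume_Icc, add_sub_cancel_left] at hle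
    exact (ENNReal.ofReal_le_ofReal_iff hb0).1 hle
  set i : ℝ → ENNReal := J.indicator fun _ => ENNReal.ofReal ρ with hi
  have him : Measurable i := measurable_const.indicator hJm
  -- The subtraction is truncated, but loses nothing because `hdom` gives `i ≤ f`.
  set g : ℝ → ENNReal := fun x => ENNReal.ofReal (f x) - i x with hg
  have hgm : AEMeasurable g volume := hf_meas.ennreal_ofReal.sub him.aemeasurable
  set M := (volume : Measure ℝ).withDensity g with hM
  have hFM : F = M + ENNReal.ofReal ρ • volume.restrict J := by
    rw [hf_density, hM, ← withDensity_indicator_const J hJm, ← withDensity_add_right _ him]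
    congr 1
    ext x
    refine (tsub_add_cancel_of_le ?_).symm
    by_cases hx : x ∈ J
    · rw [hi, indicator_of_mem hx]
      exact ENNReal.ofReal_le_ofReal (hdom x hx).le
    · rw [hi, indicator_of_notMem hx]
      exact zero_le
  have hMF : M ≤ F := by
    rw [hFM]
    exact Measure.le_add_right le_rfl
  have hMfin : IsFiniteMeasure M := isFiniteMeasure_of_le F hMF
  -- The strict inequality in `hdom` is what leaves mass in `M`, hence gives `3b/2 < 1`.
  have hMpos : M univ ≠ 0 := by
    intro h0
    refine hJpos (volume_eq_zero_of_withDensity hgm (fun x hx => ?_)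
      (measure_mono_null (subset_univ J) h0))
    rw [hg]
    simp only [hi, indicator_of_mem hx]
    exact (tsub_pos_of_lt ((ENNReal.ofReal_lt_ofReal_iff_of_nonneg hρ0).2 (hdom x hx))).ne'
  have hρc : ρ * (2 * h) = 3 * b / 2 := by
    rw [hρ]
    field_simp
    ring
  have hone : M univ + ENNReal.ofReal (3 * b / 2) = 1 := by
    rw [← hρc, ENNReal.ofReal_mul hρ0, ← hJvol, ← measure_univ (μ := F)]
    conv_rhs => rw [hFM]
    simp
  have hc1 : 3 * b / 2 < 1 := by
    rw [← ENNReal.ofReal_lt_one, ← hone, add_comm]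
    exact ENNReal.lt_add_right ENNReal.ofReal_ne_top hMpos
  have hmass : M univ = ENNReal.ofReal (1 - 3 * b / 2) := by
    rw [ENNReal.ofReal_sub _ (by positivity), ENNReal.ofReal_one]
    exact ENNReal.eq_sub_of_add_eq ENNReal.ofReal_ne_top hone
  have hFint : Integrable (fun x => x - 1) F := by
    refine Integrable.of_bound (by fun_prop) (|a - 1| + b) ?_
    filter_upwards [hFI] with x hx
    rw [Real.norm_eq_abs, abs_le]
    constructor
    · linarith [neg_abs_le (a - 1), hx.1]
    · linarith [le_abs_self (a - 1), hx.2]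
  have hMint : Integrable (fun x => x - 1) M := hFint.mono_measure hMF
  have hJint : ∫ x in J, (x - 1) = 0 := by
    rw [hJ, integral_Icc_eq_integral_Ioc, ← intervalIntegral.integral_of_le (by linarith),
      intervalIntegral.integral_sub (by simp) (by simp), integral_id,
      intervalIntegral.integral_const, smul_eq_mul]
    ring
  have hF0 : ∫ x, (x - 1) ∂F = 0 := by
    have hid : Integrable (fun x : ℝ => x) F := by
      refine (hFint.add (integrable_const (1 : ℝ))).congr (ae_of_all _ fun x => ?_)
      simp
    rw [integral_sub hid (integrable_const _), hmean]
    simp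
  have hM0 : ∫ x, (x - 1) ∂M = 0 := by
    have hUF : ENNReal.ofReal ρ • (volume : Measure ℝ).restrict J ≤ F := by
      rw [hFM]
      exact Measure.le_add_left le_rfl
    rw [hFM, integral_add_measure hMint (hFint.mono_measure hUF), integral_smul_measure, hJint]
      at hF0
    simpa using hF0
  have hMmean := lintegral_pos_part_eq_neg_part hMint hM0
  simp only [neg_sub] at hMmean
  obtain ⟨P, h1, h2, h3⟩ := exists_coupling_of_add_uniform (M := M) (a := a) hh hb rfl hc1 hmass
    (withDensity_absolutelyContinuous _ _ Real.volume_singleton) hMmean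
    hMint.lintegral_lt_top.ne (Filter.Eventually.filter_mono (ae_mono hMF) hFI)
  refine mem_sumUniformLaws_two_of_coupling h1 h2 (h3.trans ?_)
  rw [hFM]
  congr 3
  rw [hρ]
  field_simp
  norm_num
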